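/- Let $X_1, X_2, \ldots$ be i.i.d. random elements of a measurable space $\mathcal X$, let $\Theta$ be a measurable space and let $f : \Theta \times \mathcal X \to [0,1]$ be measurable. Write $$\mu_\theta := \mathbb E[f(\theta, X_1)], \qquad \hat\mu_\theta := \frac1n \sum_{i=1}^n f(\theta, X_i), \qquad \hat V(P_n) := \frac1n \int \sum_{i=1}^n \big(f(\theta, X_i) - \hat\mu_\theta\big)^2 \, dP_n(\theta).$$ Let $\delta \in (0,1]$ and let $P_0$ be a probability measure on $\Theta$ (a prior, which does not depend on the sample), and set $$\mathcal C_{n,\delta} := \mathrm{KL}(P_n \| P_0) + \ln \frac{\sqrt\pi\, \Gamma(n+1)}{\Gamma(n + \frac12)} + \ln \frac1\delta,$$ where $\mathrm{KL}(P_n\|P_0) = \int \ln \frac{dP_n}{dP_0} \, dP_n$ if $P_n \ll P_0$, and $+\infty$ otherwise. Then with probability at least $1-\delta$ over the sequence $(X_i)_{i \ge 1}$, simultaneously for all integers $n \geq 1$ and all data-dependent distributions $P_n = P(X_1, \ldots, X_n)$ on $\Theta$, where $P$ is a probability kernel from $\mathcal X^n$ to $\Theta$, we have $$\left| \int \mu_\theta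 \, dP_n(\theta) - \int \hat\mu_\theta \, dP_n(\theta) \right| \leq \frac{\sqrt{2\, \mathcal C_{n,\delta}\, \hat V(P_n)}}{\big(\sqrt n - \frac{2}{\sqrt n}\, \mathcal C_{n,\delta}\big)_+} + \frac{2\, \mathcal C_{n,\delta}}{\big(n - 2\, \mathcal C_{n,\delta}\big)_+}.$$ Here $(x)_+ = \max\{x, 0\}$, and the right-hand side is read as $+\infty$ when $2\,\mathcal C_{n,\delta} \ge n$. -/

import Mathlib

open MeasureTheory ProbabilityTheory
open scoped ENNReal

namespace PACBayes

noncomputable section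

variable {Ω 𝒳 Θ : Type*} [MeasurableSpace Ω] [MeasurableSpace 𝒳] [MeasurableSpace Θ]

/-- The mean `μ_θ = 𝔼[f(θ, Y)]`, where `Y` is a random element on `(Ω, Pr)`. -/
def mean (Pr : Measure Ω) (Y : Ω → 𝒳) (f : Θ → 𝒳 → ℝ) (θ : Θ) : ℝ :=
  ∫ ω, f θ (Y ω) ∂Pr

/-- The empirical mean `μ̂_θ = (1/n) ∑ᵢ f(θ, xᵢ)` on the sample `x = (x₁, …, xₙ)`. -/
def empMean (f : Θ → 𝒳 → ℝ) {n : ℕ} (x : Fin n → 𝒳) (θ : Θ) : ℝ :=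
  (1 / (n : ℝ)) * ∑ i, f θ (x i)

/-- The posterior-averaged sample variance
`V̂(Q) = (1/n) ∫ ∑ᵢ (f(θ, xᵢ) - μ̂_θ)² dQ(θ)`. -/
def sampleVar (f : Θ → 𝒳 → ℝ) {n : ℕ} (x : Fin n → 𝒳) (Q : Measure Θ) : ℝ :=
  (1 / (n : ℝ)) * ∫ θ, ∑ i, (f θ (x i) - empMean f x θ) ^ 2 ∂Q

/-- The complexity `C_{n,δ} = KL(Q ‖ P₀) + ln (√π Γ(n+1) / Γ(n+1/2)) + ln (1/δ)`, with values in
`[0, ∞]`; it is `∞` exactly when `KL(Q ‖ P₀) = ∞`. Both logarithms are nonnegative for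
`0 < δ ≤ 1`, so that `ENNReal.ofReal` does not truncate them. -/
def complexity (n : ℕ) (δ : ℝ) (Q P₀ : Measure Θ) : ℝ≥0∞ :=
  InformationTheory.klDiv Q P₀
    + ENNReal.ofReal
        (Real.log (Real.sqrt Real.pi * Real.Gamma ((n : ℝ) + 1) / Real.Gamma ((n : ℝ) + 1 / 2)))
    + ENNReal.ofReal (Real.log (1 / δ))

/-- The empirical Bernstein width
`√(2 C V) / (√n - (2/√n) C)₊ + 2 C / (n - 2 C)₊`, computed in `[0, ∞]`: there subtraction is
`a - b = (a - b)₊` and a positive number divided by `0` is `∞`. -/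
def bernsteinWidth (n : ℕ) (C V : ℝ≥0∞) : ℝ≥0∞ :=
  (2 * C * V) ^ (1 / 2 : ℝ) /
      ((n : ℝ≥0∞) ^ (1 / 2 : ℝ) - 2 / (n : ℝ≥0∞) ^ (1 / 2 : ℝ) * C)
    + 2 * C / ((n : ℝ≥0∞) - 2 * C)

end

end PACBayes

/-!
Let a gambler bet against each hypothesis `θ`: he stakes a fraction `b` of his capital on the
outcome `f θ (X i)` and `1 - b` on its complement, at the odds that are fair for `μ_θ`. By Cover and
Ordentlich, averaging the wealth over `b ∼ Beta(1/2, 1/2)` loses at most the factor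
`√π Γ(n+1) / Γ(n+1/2)` against the best constant `b` in hindsight. Averaging also over `θ ∼ P₀`
gives a nonnegative supermartingale with initial value one, and Ville's inequality keeps it below
`1/δ` for all `n` at once, with probability at least `1 - δ`.

On this event, reparametrize `b` by a signed fraction `g` with `|g| < 1` that multiplies the capital
by `(1 + g (a - μ̂_θ)) / (1 - g (μ̂_θ - μ_θ))` at the outcome `a`. As
`log (1 + y) ≥ y - y² / (2 (1 - |g|))` for `y ≥ -|g|`, the wealth is at least the exponential of
`n (g (μ̂_θ - μ_θ) - g² V̂_θ / (2 (1 - |g|)))`, where `V̂_θ` is the sample variance. The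
Donsker–Varadhan inequality turns the `P₀`-average of this exponential into a bound
`n (g Δ - g² V̂ / (2 (1 - |g|))) ≤ C` on the `Q`-averages `Δ` and `V̂`, for every `Q`. The choice
`g = Δ / (V̂ + |Δ|)` then gives `n Δ² ≤ 2 C (V̂ + |Δ|)`, a quadratic inequality in `|Δ|`.
-/

namespace PACBayes

section LogInequalities

lemma sub_sq_div_two_le_log_one_add {y : ℝ} (hy : 0 ≤ y) : y - y ^ 2 / 2 ≤ Real.log (1 + y) := by
  refine le_trans ?_ (Real.le_log_one_add_of_nonneg hy)
  rw [le_div_iff₀ (by linarith)]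
  nlinarith [pow_nonneg hy 3]

lemma sub_sq_div_le_log_one_add_of_nonpos {y : ℝ} (hy : -1 < y) (hy0 : y ≤ 0) :
    y - y ^ 2 / (2 * (1 + y)) ≤ Real.log (1 + y) := by
  have hpos : 0 < 1 + y := by linarith
  have hsinh := Real.self_le_sinh_iff.2
    (Real.log_nonneg ((one_le_inv₀ hpos).2 (by linarith)))
  rw [Real.sinh_log (inv_pos.2 hpos), Real.log_inv, inv_inv] at hsinh
  have hrat : ((1 + y)⁻¹ - (1 + y)) / 2 = -y + y ^ 2 / (2 * (1 + y)) := by field_simp; ring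
  linarith

lemma sub_sq_div_le_log_one_add {g y : ℝ} (hg0 : 0 ≤ g) (hg : g < 1) (hy : -g ≤ y) :
    y - y ^ 2 / (2 * (1 - g)) ≤ Real.log (1 + y) := by
  rcases le_total 0 y with h | h
  · refine le_trans (sub_le_sub_left ?_ y) (sub_sq_div_two_le_log_one_add h)
    exact div_le_div_of_nonneg_left (sq_nonneg y) (by linarith) (by linarith)
  · refine le_trans (sub_le_sub_left ?_ y) (sub_sq_div_le_log_one_add_of_nonpos (by linarith) h)
    exact div_le_div_of_nonneg_left (sq_nonneg y) (by linarith) (by linarith)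

end LogInequalities

section KrichevskyTrofimov

lemma mul_le_mul_of_monotone_ratio {u : ℕ → ℝ} (hu : ∀ n, 0 < u n)
    (hmono : Monotone fun n => u (n + 1) / u n) (k l : ℕ) : u k * u l ≤ u 0 * u (k + l) := by
  induction l with
  | zero => exact (mul_comm _ _).le
  | succ l ih =>
    have hstep (n : ℕ) : u (n + 1) = u n * (u (n + 1) / u n) := (mul_div_cancel₀ _ (hu n).ne').symm
    have hratio (n : ℕ) : 0 ≤ u (n + 1) / u n := (div_pos (hu _) (hu n)).le
    calc u k * u (l + 1) = u k * u l * (u (l + 1) / u l) := by rw [mul_assoc, ← hstep]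
      _ ≤ u 0 * u (k + l) * (u (k + l + 1) / u (k + l)) :=
        mul_le_mul ih (hmono (Nat.le_add_left l k)) (hratio l) (mul_pos (hu 0) (hu _)).le
      _ = u 0 * u (k + (l + 1)) := by rw [mul_assoc, ← hstep, add_assoc]

lemma hasDerivAt_mul_log_succ_sub {x : ℝ} (hx : 0 < x) :
    HasDerivAt (fun x : ℝ => (x + 1) * Real.log (x + 1) - x * Real.log x - Real.log (x + 1 / 2))
      (Real.log (1 + 1 / x) - 2 * (1 / x) / (1 / x + 2)) x := by
  have h1 : HasDerivAt (fun x : ℝ => (x + 1) * Real.log (x + 1)) (Real.log (x + 1) + 1) x :=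
    (Real.hasDerivAt_mul_log (by positivity)).comp_add_const x 1
  have h2 : HasDerivAt (fun x : ℝ => Real.log (x + 1 / 2)) (x + 1 / 2)⁻¹ x :=
    (Real.hasDerivAt_log (by positivity)).comp_add_const x (1 / 2)
  refine ((h1.sub (Real.hasDerivAt_mul_log hx.ne')).sub h2).congr_deriv ?_
  have hlog : Real.log (1 + 1 / x) = Real.log (x + 1) - Real.log x := by
    rw [← Real.log_div (by positivity) hx.ne', add_div, div_self hx.ne']
  rw [hlog]
  field_simp
  ring

lemma monotoneOn_mul_log_succ_sub :
    MonotoneOn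
      (fun x : ℝ => (x + 1) * Real.log (x + 1) - x * Real.log x - Real.log (x + 1 / 2))
      (Set.Ici 0) := by
  refine monotoneOn_of_hasDerivWithinAt_nonneg (convex_Ici 0) ?_
    (fun x hx => (hasDerivAt_mul_log_succ_sub (by simpa using hx)).hasDerivWithinAt) ?_
  · refine ((Real.continuous_mul_log.comp (continuous_add_const 1)).sub
      Real.continuous_mul_log).continuousOn.sub (ContinuousOn.log (by fun_prop) fun x hx => ?_)
    have : 0 ≤ x := hx
    positivity
  · intro x hx
    have hx0 : 0 < x := by simpa using hx
    exact sub_nonneg.2 (Real.le_log_one_add_of_nonneg (by positivity))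

lemma natCast_pow_self_pos (n : ℕ) : 0 < (n : ℝ) ^ n := by
  exact_mod_cast Nat.pow_self_pos

lemma natCast_pow_self_eq_exp (n : ℕ) : (n : ℝ) ^ n = Real.exp (n * Real.log n) := by
  rw [← Real.log_pow, Real.exp_log (natCast_pow_self_pos n)]

lemma Gamma_add_half_pos (n : ℕ) : 0 < Real.Gamma ((n : ℝ) + 1 / 2) :=
  Real.Gamma_pos_of_pos (by positivity)

/-- The sequence `nⁿ / Γ(n+1/2)`, normalizing the factors `kᵏ`, `lˡ` of the maximum likelihood
`kᵏ lˡ / (k+l)ᵏ⁺ˡ` of a binary string by the corresponding factors of its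
Krichevsky–Trofimov likelihood. -/
noncomputable def ktQuotient (n : ℕ) : ℝ :=
  (n : ℝ) ^ n / Real.Gamma (n + 1 / 2)

lemma ktQuotient_pos (n : ℕ) : 0 < ktQuotient n :=
  div_pos (natCast_pow_self_pos n) (Gamma_add_half_pos n)

lemma ktQuotient_zero : ktQuotient 0 = 1 / √Real.pi := by
  simp only [ktQuotient, pow_zero, Nat.cast_zero, zero_add, Real.Gamma_one_half_eq]

lemma ktQuotient_succ_div (n : ℕ) : ktQuotient (n + 1) / ktQuotient n =
    Real.exp (((n : ℝ) + 1) * Real.log (n + 1) - n * Real.log n - Real.log (n + 1 / 2)) := by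
  have hΓ : Real.Gamma ((n : ℝ) + 1 + 1 / 2) = (n + 1 / 2) * Real.Gamma (n + 1 / 2) := by
    rw [add_right_comm, Real.Gamma_add_one (by positivity)]
  have hn1 := natCast_pow_self_eq_exp (n + 1)
  rw [Nat.cast_succ] at hn1
  rw [Real.exp_sub, Real.exp_sub, Real.exp_log (by positivity), ← natCast_pow_self_eq_exp, ← hn1,
    ktQuotient, ktQuotient, Nat.cast_succ, hΓ, div_div_div_eq, mul_right_comm,
    mul_div_mul_right _ _ (Gamma_add_half_pos n).ne', div_div, mul_comm (_ ^ n)]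

lemma monotone_ktQuotient_succ_div : Monotone fun n => ktQuotient (n + 1) / ktQuotient n := by
  intro k l hkl
  simp only [ktQuotient_succ_div]
  exact Real.exp_le_exp.2 (monotoneOn_mul_log_succ_sub (Set.mem_Ici.2 k.cast_nonneg)
    (Set.mem_Ici.2 l.cast_nonneg) (Nat.cast_le.2 hkl))

lemma pow_le_pow_self_mul_exp (n : ℕ) {t : ℝ} (ht : 0 ≤ t) :
    t ^ n ≤ (n : ℝ) ^ n * Real.exp (t - n) := by
  rcases Nat.eq_zero_or_pos n with rfl | hn
  · simpa using ht
  have hn' : (0 : ℝ) < n := by exact_mod_cast hn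
  have htangent : t ≤ n * Real.exp ((t - n) / n) := by
    have := Real.add_one_le_exp ((t - n) / n)
    rw [sub_div, div_self hn'.ne', sub_add_cancel, div_le_iff₀' hn'] at this
    rwa [sub_div, div_self hn'.ne']
  calc t ^ n ≤ (n * Real.exp ((t - n) / n)) ^ n := pow_le_pow_left₀ ht htangent n
    _ = (n : ℝ) ^ n * Real.exp (t - n) := by
      rw [mul_pow, ← Real.exp_nat_mul, mul_div_cancel₀ _ hn'.ne']

lemma pow_mul_one_sub_pow_le (k l : ℕ) {b : ℝ} (hb : b ∈ Set.Icc (0 : ℝ) 1) :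
    b ^ k * (1 - b) ^ l ≤ (k : ℝ) ^ k * (l : ℝ) ^ l / ((k + l : ℕ) : ℝ) ^ (k + l) := by
  have hb0 := hb.1
  have hb1 : 0 ≤ 1 - b := sub_nonneg.2 hb.2
  have hk := pow_le_pow_self_mul_exp k (t := (k + l : ℕ) * b) (by positivity)
  have hl := pow_le_pow_self_mul_exp l (t := (k + l : ℕ) * (1 - b)) (by positivity)
  rw [le_div_iff₀ (natCast_pow_self_pos _)]
  calc b ^ k * (1 - b) ^ l * ((k + l : ℕ) : ℝ) ^ (k + l)
      = ((k + l : ℕ) * b) ^ k * ((k + l : ℕ) * (1 - b)) ^ l := by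
        rw [mul_pow, mul_pow, pow_add]
        ring
    _ ≤ (k : ℝ) ^ k * Real.exp ((k + l : ℕ) * b - k) *
          ((l : ℝ) ^ l * Real.exp ((k + l : ℕ) * (1 - b) - l)) :=
        mul_le_mul hk hl (by positivity) (by positivity)
    _ = (k : ℝ) ^ k * (l : ℝ) ^ l := by
        rw [mul_mul_mul_comm, ← Real.exp_add]
        have hzero : ((k + l : ℕ) : ℝ) * b - k + ((k + l : ℕ) * (1 - b) - l) = 0 := by
          push_cast
          ring
        rw [hzero, Real.exp_zero, mul_one]

/-- The worst-case ratio `√π Γ(n+1) / Γ(n+1/2)` between the maximum likelihood of a binary string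
of length `n` and its likelihood under the Krichevsky–Trofimov mixture; it is attained at constant
strings. -/
noncomputable def ktRegret (n : ℕ) : ℝ :=
  √Real.pi * Real.Gamma ((n : ℝ) + 1) / Real.Gamma ((n : ℝ) + 1 / 2)

lemma ktRegret_pos (n : ℕ) : 0 < ktRegret n :=
  div_pos (mul_pos (Real.sqrt_pos.2 Real.pi_pos) (Real.Gamma_pos_of_pos (by positivity)))
    (Real.Gamma_pos_of_pos (by positivity))

lemma beta_half_half : beta (1 / 2) (1 / 2) = Real.pi := by
  rw [beta, Real.Gamma_one_half_eq, Real.mul_self_sqrt Real.pi_pos.le]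
  norm_num

lemma pow_mul_one_sub_pow_le_ktRegret_mul_beta (k l : ℕ) {b : ℝ} (hb : b ∈ Set.Icc (0 : ℝ) 1) :
    b ^ k * (1 - b) ^ l ≤
      ktRegret (k + l) * (beta (1 / 2 + k) (1 / 2 + l) / beta (1 / 2) (1 / 2)) := by
  have := Gamma_add_half_pos k
  have := Gamma_add_half_pos l
  have hsum : (1 : ℝ) / 2 + k + (1 / 2 + l) = (k + l : ℕ) + 1 := by push_cast; ring
  have : 0 < Real.Gamma (((k + l : ℕ) : ℝ) + 1) := Real.Gamma_pos_of_pos (by positivity)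
  have hπ : √Real.pi ^ 2 = Real.pi := Real.sq_sqrt Real.pi_pos.le
  have hquot := mul_le_mul_of_monotone_ratio ktQuotient_pos monotone_ktQuotient_succ_div k l
  rw [ktQuotient_zero, ktQuotient, ktQuotient, div_mul_div_comm, div_le_iff₀ (by positivity)]
    at hquot
  calc b ^ k * (1 - b) ^ l ≤ (k : ℝ) ^ k * (l : ℝ) ^ l / ((k + l : ℕ) : ℝ) ^ (k + l) :=
        pow_mul_one_sub_pow_le k l hb
    _ ≤ 1 / √Real.pi * ktQuotient (k + l) *
          (Real.Gamma (k + 1 / 2) * Real.Gamma (l + 1 / 2)) / ((k + l : ℕ) : ℝ) ^ (k + l) :=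
        div_le_div_of_nonneg_right hquot (natCast_pow_self_pos _).le
    _ = ktRegret (k + l) * (beta (1 / 2 + k) (1 / 2 + l) / beta (1 / 2) (1 / 2)) := by
        have := natCast_pow_self_pos (k + l)
        rw [beta_half_half, ktQuotient, ktRegret, beta, hsum, add_comm (1 / 2 : ℝ),
          add_comm (1 / 2 : ℝ)]
        field_simp
        rw [hπ]

end KrichevskyTrofimov

section UniversalPortfolio

lemma ae_betaMeasure_mem_Ioo (α β : ℝ) : ∀ᵐ b ∂betaMeasure α β, b ∈ Set.Ioo (0 : ℝ) 1 := by
  rw [betaMeasure, ae_withDensity_iff (show Measurable (betaPDF α β) from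
    (measurable_betaPDFReal α β).ennreal_ofReal)]
  refine Filter.Eventually.of_forall fun b hb => ?_
  contrapose! hb
  rw [betaPDF_eq, if_neg (show ¬(0 < b ∧ b < 1) from hb), ENNReal.ofReal_zero]

lemma betaPDF_mul_pow_mul_one_sub_pow {α β : ℝ} (hα : 0 < α) (hβ : 0 < β) (k l : ℕ) (b : ℝ) :
    betaPDF α β b * ENNReal.ofReal (b ^ k * (1 - b) ^ l) =
      ENNReal.ofReal (beta (α + k) (β + l) / beta α β) * betaPDF (α + k) (β + l) b := by
  by_cases hb : 0 < b ∧ b < 1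
  · obtain ⟨hb0, hb1⟩ := hb
    have h1b : 0 < 1 - b := sub_pos.2 hb1
    have hαβ : 0 < beta α β := beta_pos hα hβ
    have hkl : 0 < beta (α + k) (β + l) := beta_pos (by positivity) (by positivity)
    rw [betaPDF_of_pos_lt_one hb0 hb1, betaPDF_of_pos_lt_one hb0 hb1,
      ← ENNReal.ofReal_mul (by positivity), ← ENNReal.ofReal_mul (by positivity),
      add_sub_right_comm, add_sub_right_comm, Real.rpow_add_natCast hb0.ne',
      Real.rpow_add_natCast h1b.ne']
    congr 1
    generalize beta (α + k) (β + l) = B at hkl ⊢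
    field_simp
  · simp only [betaPDF_eq, if_neg hb, ENNReal.ofReal_zero, zero_mul, mul_zero]

lemma lintegral_pow_mul_one_sub_pow_betaMeasure {α β : ℝ} (hα : 0 < α) (hβ : 0 < β) (k l : ℕ) :
    ∫⁻ b, ENNReal.ofReal (b ^ k * (1 - b) ^ l) ∂betaMeasure α β =
      ENNReal.ofReal (beta (α + k) (β + l) / beta α β) := by
  have hmeas (α β : ℝ) : Measurable (betaPDF α β) := (measurable_betaPDFReal α β).ennreal_ofReal
  rw [betaMeasure, lintegral_withDensity_eq_lintegral_mul _ (hmeas α β) (by fun_prop)]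
  simp only [Pi.mul_apply, betaPDF_mul_pow_mul_one_sub_pow hα hβ]
  rw [lintegral_const_mul _ (hmeas _ _), lintegral_betaPDF_eq_one (by positivity) (by positivity),
    mul_one]

/-- The Krichevsky–Trofimov (Jeffreys) prior `Beta(1/2, 1/2)` on the parameter of a coin. -/
noncomputable def ktPrior : Measure ℝ :=
  betaMeasure (1 / 2) (1 / 2)

instance : IsProbabilityMeasure ktPrior :=
  isProbabilityMeasureBeta one_half_pos one_half_pos

lemma ae_ktPrior_mem_Icc : ∀ᵐ b ∂ktPrior, b ∈ Set.Icc (0 : ℝ) 1 :=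
  (ae_betaMeasure_mem_Ioo _ _).mono fun _ hb => Set.Ioo_subset_Icc_self hb

variable {ι : Type*} [Fintype ι]

/-- The wealth of the constant rebalanced portfolio `(b, 1 - b)` on two assets with price relatives
`x i` and `y i`. -/
noncomputable def portfolioWealth (x y : ι → ℝ≥0∞) (b : ℝ) : ℝ≥0∞ :=
  ∏ i, (ENNReal.ofReal b * x i + ENNReal.ofReal (1 - b) * y i)

lemma portfolioWealth_eq_sum [DecidableEq ι] (x y : ι → ℝ≥0∞) {b : ℝ}
    (hb : b ∈ Set.Icc (0 : ℝ) 1) :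
    portfolioWealth x y b = ∑ t : Finset ι,
      ENNReal.ofReal (b ^ t.card * (1 - b) ^ tᶜ.card) * ((∏ i ∈ t, x i) * ∏ i ∈ tᶜ, y i) := by
  have h1b : 0 ≤ 1 - b := sub_nonneg.2 hb.2
  rw [portfolioWealth, Fintype.prod_add]
  refine Finset.sum_congr rfl fun t _ => ?_
  rw [Finset.prod_mul_distrib, Finset.prod_mul_distrib, Finset.prod_const, Finset.prod_const,
    ENNReal.ofReal_mul (pow_nonneg hb.1 _), ENNReal.ofReal_pow hb.1, ENNReal.ofReal_pow h1b,
    mul_mul_mul_comm]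

lemma lintegral_portfolioWealth_ktPrior [DecidableEq ι] (x y : ι → ℝ≥0∞) :
    ∫⁻ b, portfolioWealth x y b ∂ktPrior = ∑ t : Finset ι,
      ENNReal.ofReal (beta (1 / 2 + t.card) (1 / 2 + tᶜ.card) / beta (1 / 2) (1 / 2)) *
        ((∏ i ∈ t, x i) * ∏ i ∈ tᶜ, y i) := by
  rw [lintegral_congr_ae (ae_ktPrior_mem_Icc.mono fun b hb => portfolioWealth_eq_sum x y hb),
    lintegral_finsetSum _ (fun t _ => by fun_prop)]
  refine Finset.sum_congr rfl fun t _ => ?_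
  rw [lintegral_mul_const _ (by fun_prop), ktPrior,
    lintegral_pow_mul_one_sub_pow_betaMeasure one_half_pos one_half_pos]

/-- The universal portfolio of Cover and Ordentlich competes with every constant rebalanced
portfolio: expanding both wealths over the subsets of rounds reduces the claim to binary strings. -/
lemma portfolioWealth_le_ktRegret_mul_lintegral (x y : ι → ℝ≥0∞) {b : ℝ}
    (hb : b ∈ Set.Icc (0 : ℝ) 1) :
    portfolioWealth x y b ≤
      ENNReal.ofReal (ktRegret (Fintype.card ι)) * ∫⁻ b, portfolioWealth x y b ∂ktPrior := by
  classical
  rw [lintegral_portfolioWealth_ktPrior, portfolioWealth_eq_sum x y hb, Finset.mul_sum]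
  refine Finset.sum_le_sum fun t _ => ?_
  rw [← mul_assoc (ENNReal.ofReal (ktRegret _)), ← ENNReal.ofReal_mul (ktRegret_pos _).le,
    ← Finset.card_add_card_compl t]
  exact mul_le_mul_left (ENNReal.ofReal_le_ofReal
    (pow_mul_one_sub_pow_le_ktRegret_mul_beta _ _ hb)) _

lemma portfolioWealth_half_eq_top {x y : ι → ℝ≥0∞} (htop : ∃ i, x i = ⊤)
    (hpos : ∀ i, x i ≠ 0 ∨ y i ≠ 0) : portfolioWealth x y (1 / 2) = ⊤ := by
  classical
  obtain ⟨j, hj⟩ := htop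
  have hhalf : ENNReal.ofReal (1 / 2) ≠ 0 := ENNReal.ofReal_ne_zero_iff.2 one_half_pos
  rw [portfolioWealth, sub_half, ← Finset.mul_prod_erase _ _ (Finset.mem_univ j), hj,
    ENNReal.mul_top hhalf, top_add, ENNReal.top_mul]
  refine Finset.prod_ne_zero_iff.2 fun i _ => ?_
  rw [← mul_add]
  refine mul_ne_zero hhalf fun h => ?_
  rw [add_eq_zero] at h
  exact (hpos i).elim (· h.1) (· h.2)

end UniversalPortfolio

section Betting

/-- The wealth factor of a gambler who stakes the fraction `b` on the outcome `a ∈ [0, 1]` and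
`1 - b` on `1 - a`, at the odds that are fair for the mean `m`. When `m ∈ {0, 1}`, an outcome of
probability zero pays `∞`, as `a / 0 = ∞` for `a ≠ 0` in `ℝ≥0∞`. -/
noncomputable def betFactor (b m a : ℝ) : ℝ≥0∞ :=
  ENNReal.ofReal b * (ENNReal.ofReal a / ENNReal.ofReal m)
    + ENNReal.ofReal (1 - b) * (ENNReal.ofReal (1 - a) / ENNReal.ofReal (1 - m))

lemma betFactor_one_sub (b m a : ℝ) : betFactor (1 - b) (1 - m) (1 - a) = betFactor b m a := by
  simp only [betFactor, sub_sub_cancel, add_comm]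

lemma lintegral_betFactor_le_one {Ω : Type*} [MeasurableSpace Ω] {Pr : Measure Ω}
    [IsProbabilityMeasure Pr] {Y : Ω → ℝ} (hY : Measurable Y) (hY01 : ∀ ω, Y ω ∈ Set.Icc (0 : ℝ) 1)
    {b : ℝ} (hb : b ∈ Set.Icc (0 : ℝ) 1) : ∫⁻ ω, betFactor b (∫ ω, Y ω ∂Pr) (Y ω) ∂Pr ≤ 1 := by
  have hint : Integrable Y Pr :=
    Integrable.of_mem_Icc 0 1 hY.aemeasurable (Filter.Eventually.of_forall hY01)
  have hwin : ∫⁻ ω, ENNReal.ofReal (Y ω) ∂Pr = ENNReal.ofReal (∫ ω, Y ω ∂Pr) :=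
    (ofReal_integral_eq_lintegral_ofReal hint
      (Filter.Eventually.of_forall fun ω => (hY01 ω).1)).symm
  have hlose : ∫⁻ ω, ENNReal.ofReal (1 - Y ω) ∂Pr = ENNReal.ofReal (1 - ∫ ω, Y ω ∂Pr) := by
    have hint' : Integrable (fun ω => 1 - Y ω) Pr := (integrable_const 1).sub hint
    rw [← ofReal_integral_eq_lintegral_ofReal hint'
      (Filter.Eventually.of_forall fun ω => sub_nonneg.2 (hY01 ω).2),
      integral_sub (integrable_const 1) hint, integral_const, probReal_univ, one_smul]
  simp only [betFactor, div_eq_mul_inv]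
  rw [lintegral_add_left (by fun_prop), lintegral_const_mul _ (by fun_prop),
    lintegral_const_mul _ (by fun_prop), lintegral_mul_const _ (by fun_prop),
    lintegral_mul_const _ (by fun_prop), hwin, hlose, ← div_eq_mul_inv, ← div_eq_mul_inv]
  calc _ ≤ ENNReal.ofReal b * 1 + ENNReal.ofReal (1 - b) * 1 := by
        gcongr <;> exact ENNReal.div_self_le_one
    _ = 1 := by
        rw [mul_one, mul_one, ← ENNReal.ofReal_add hb.1 (sub_nonneg.2 hb.2), add_sub_cancel,
          ENNReal.ofReal_one]

lemma abs_sub_le_one {a c : ℝ} (ha : a ∈ Set.Icc (0 : ℝ) 1) (hc : c ∈ Set.Icc (0 : ℝ) 1) :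
    |a - c| ≤ 1 := by
  simpa [Real.dist_eq] using Real.dist_le_of_mem_Icc_01 ha hc

lemma neg_abs_le_mul_sub {a c : ℝ} (ha : a ∈ Set.Icc (0 : ℝ) 1) (hc : c ∈ Set.Icc (0 : ℝ) 1)
    (g : ℝ) : -|g| ≤ g * (a - c) := by
  refine (abs_le.1 ?_).1
  rw [abs_mul]
  exact mul_le_of_le_one_right (abs_nonneg g) (abs_sub_le_one ha hc)

lemma exp_le_one_add_div_one_sub {a c m g : ℝ} (ha : a ∈ Set.Icc (0 : ℝ) 1)
    (hc : c ∈ Set.Icc (0 : ℝ) 1) (hm : m ∈ Set.Icc (0 : ℝ) 1) (hg : |g| < 1) :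
    Real.exp (g * (a - m) - g ^ 2 / (2 * (1 - |g|)) * (a - c) ^ 2) ≤
      (1 + g * (a - c)) / (1 - g * (c - m)) := by
  have hlog := sub_sq_div_le_log_one_add (abs_nonneg g) hg (neg_abs_le_mul_sub ha hc g)
  have hnum : 0 < 1 + g * (a - c) := by linarith [neg_abs_le_mul_sub ha hc g]
  have hden : 0 < 1 - g * (c - m) := by linarith [neg_abs_le_mul_sub hm hc g]
  have hlogden := Real.log_le_sub_one_of_pos hden
  rw [← Real.exp_log (div_pos hnum hden), Real.log_div hnum.ne' hden.ne']
  refine Real.exp_le_exp.2 ?_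
  rw [mul_pow, mul_div_right_comm] at hlog
  linarith

lemma exists_betFactor_eq {c m g : ℝ} (hc : c ∈ Set.Icc (0 : ℝ) 1) (hm : m ∈ Set.Ioo (0 : ℝ) 1)
    (hg : |g| < 1) :
    ∃ b ∈ Set.Icc (0 : ℝ) 1, ∀ a ∈ Set.Icc (0 : ℝ) 1,
      betFactor b m a = ENNReal.ofReal ((1 + g * (a - c)) / (1 - g * (c - m))) := by
  obtain ⟨hm0, hm1⟩ := hm
  have h1m : 0 < 1 - m := sub_pos.2 hm1
  have hden : 0 < 1 - g * (c - m) := by linarith [neg_abs_le_mul_sub ⟨hm0.le, hm1.le⟩ hc g]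
  have hwin : 0 < 1 + g * (1 - c) := by
    linarith [neg_abs_le_mul_sub (Set.right_mem_Icc.2 zero_le_one) hc g]
  have hlose : 0 < 1 - g * c := by
    linarith [neg_abs_le_mul_sub (Set.left_mem_Icc.2 zero_le_one) hc g]
  set b := m * (1 + g * (1 - c)) / (1 - g * (c - m)) with hb
  have h1b : 1 - b = (1 - m) * (1 - g * c) / (1 - g * (c - m)) := by
    rw [hb]; field_simp; ring
  have hb0 : 0 ≤ b := by positivity
  have h1b0 : 0 ≤ 1 - b := by rw [h1b]; positivity
  refine ⟨b, ⟨hb0, sub_nonneg.1 h1b0⟩, fun a ha => ?_⟩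
  have h1a : 0 ≤ 1 - a := sub_nonneg.2 ha.2
  rw [betFactor, ← ENNReal.ofReal_div_of_pos hm0, ← ENNReal.ofReal_div_of_pos h1m,
    ← ENNReal.ofReal_mul hb0, ← ENNReal.ofReal_mul h1b0, ← ENNReal.ofReal_add
      (mul_nonneg hb0 (div_nonneg ha.1 hm0.le)) (mul_nonneg h1b0 (div_nonneg h1a h1m.le)), h1b, hb]
  congr 1
  field_simp
  ring

variable {ι : Type*} [Fintype ι]

/-- The empirical Bernstein exponent of a sample `a` against the mean `m`: the logarithmic wealth
guaranteed by the signed betting fraction `g`, with deviations measured from a centre `c`. -/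
noncomputable def bernsteinExponent (g m c : ℝ) (a : ι → ℝ) : ℝ :=
  ∑ i, (g * (a i - m) - g ^ 2 / (2 * (1 - |g|)) * (a i - c) ^ 2)

lemma bernsteinExponent_one_sub (g m c : ℝ) (a : ι → ℝ) :
    bernsteinExponent (-g) (1 - m) (1 - c) (fun i => 1 - a i) = bernsteinExponent g m c a := by
  simp only [bernsteinExponent, abs_neg]
  exact Finset.sum_congr rfl fun i _ => by ring

lemma exists_exp_bernsteinExponent_le_of_mem_Ioo {a : ι → ℝ} (ha : ∀ i, a i ∈ Set.Icc (0 : ℝ) 1)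
    {c m g : ℝ} (hc : c ∈ Set.Icc (0 : ℝ) 1) (hm : m ∈ Set.Ioo (0 : ℝ) 1) (hg : |g| < 1) :
    ∃ b ∈ Set.Icc (0 : ℝ) 1,
      ENNReal.ofReal (Real.exp (bernsteinExponent g m c a)) ≤ ∏ i, betFactor b m (a i) := by
  obtain ⟨b, hb, hfactor⟩ := exists_betFactor_eq hc hm hg
  refine ⟨b, hb, ?_⟩
  rw [bernsteinExponent, Real.exp_sum,
    ENNReal.ofReal_prod_of_nonneg fun i _ => (Real.exp_pos _).le]
  refine Finset.prod_le_prod' fun i _ => ?_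
  rw [hfactor _ (ha i)]
  exact ENNReal.ofReal_le_ofReal
    (exp_le_one_add_div_one_sub (ha i) hc (Set.Ioo_subset_Icc_self hm) hg)

lemma exists_exp_bernsteinExponent_le_of_mean_zero {a : ι → ℝ}
    (ha : ∀ i, a i ∈ Set.Icc (0 : ℝ) 1) (c : ℝ) {g : ℝ} (hg : |g| < 1) :
    ∃ b ∈ Set.Icc (0 : ℝ) 1,
      ENNReal.ofReal (Real.exp (bernsteinExponent g 0 c a)) ≤ ∏ i, betFactor b 0 (a i) := by
  by_cases hpos : ∃ j, 0 < a j
  · obtain ⟨j, hj⟩ := hpos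
    refine ⟨1 / 2, by norm_num, le_top.trans_eq (portfolioWealth_half_eq_top ⟨j, ?_⟩ ?_).symm⟩
    · rw [ENNReal.ofReal_zero, ENNReal.div_zero (ENNReal.ofReal_pos.2 hj).ne']
    · intro i
      rcases (ha i).1.eq_or_lt with hi | hi
      · right; simp [← hi]
      · left; simp [hi]
  · obtain rfl : a = 0 := funext fun i => le_antisymm (not_lt.1 fun h => hpos ⟨i, h⟩) (ha i).1
    refine ⟨0, by norm_num, ?_⟩
    have hexp : bernsteinExponent g 0 c (0 : ι → ℝ) ≤ 0 := by
      refine Finset.sum_nonpos fun i _ => ?_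
      have : 0 ≤ g ^ 2 / (2 * (1 - |g|)) * c ^ 2 :=
        mul_nonneg (div_nonneg (sq_nonneg g) (by linarith)) (sq_nonneg c)
      simpa using this
    simpa [betFactor] using hexp

lemma exists_exp_bernsteinExponent_le {a : ι → ℝ} (ha : ∀ i, a i ∈ Set.Icc (0 : ℝ) 1)
    {c m g : ℝ} (hc : c ∈ Set.Icc (0 : ℝ) 1) (hm : m ∈ Set.Icc (0 : ℝ) 1) (hg : |g| < 1) :
    ∃ b ∈ Set.Icc (0 : ℝ) 1,
      ENNReal.ofReal (Real.exp (bernsteinExponent g m c a)) ≤ ∏ i, betFactor b m (a i) := by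
  rcases hm.1.eq_or_lt with rfl | hm0
  · exact exists_exp_bernsteinExponent_le_of_mean_zero ha c hg
  rcases hm.2.eq_or_lt with rfl | hm1
  · obtain ⟨b, hb, hle⟩ := exists_exp_bernsteinExponent_le_of_mean_zero
      (fun i => Set.Icc.mem_iff_one_sub_mem.1 (ha i)) (1 - c) ((abs_neg g).trans_lt hg)
    refine ⟨1 - b, Set.Icc.mem_iff_one_sub_mem.1 hb, ?_⟩
    rw [← bernsteinExponent_one_sub, sub_self]
    refine hle.trans_eq (Finset.prod_congr rfl fun i _ => ?_)
    rw [← betFactor_one_sub (1 - b), sub_self, sub_sub_cancel]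
  · exact exists_exp_bernsteinExponent_le_of_mem_Ioo ha hc ⟨hm0, hm1⟩ hg

lemma exp_bernsteinExponent_le_ktRegret_mul_lintegral {a : ι → ℝ}
    (ha : ∀ i, a i ∈ Set.Icc (0 : ℝ) 1) {c m g : ℝ} (hc : c ∈ Set.Icc (0 : ℝ) 1)
    (hm : m ∈ Set.Icc (0 : ℝ) 1) (hg : |g| < 1) :
    ENNReal.ofReal (Real.exp (bernsteinExponent g m c a)) ≤
      ENNReal.ofReal (ktRegret (Fintype.card ι)) * ∫⁻ b, ∏ i, betFactor b m (a i) ∂ktPrior := by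
  obtain ⟨b, hb, hle⟩ := exists_exp_bernsteinExponent_le ha hc hm hg
  exact hle.trans (portfolioWealth_le_ktRegret_mul_lintegral _ _ hb)

end Betting


section Ville

variable {Ω : Type*} {mΩ : MeasurableSpace Ω} {μ : Measure Ω}

lemma mul_measure_union_add_setLIntegral_compl_le {h : Ω → ℝ≥0∞} (hh : Measurable h)
    {s : Set Ω} (hs : MeasurableSet s) (c : ℝ≥0∞) :
    c * μ (s ∪ {ω | c ≤ h ω}) + ∫⁻ ω in (s ∪ {ω | c ≤ h ω})ᶜ, h ω ∂μ ≤
      c * μ s + ∫⁻ ω in sᶜ, h ω ∂μ := by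
  have hB : MeasurableSet {ω | c ≤ h ω} := measurableSet_le measurable_const hh
  have hMarkov : c * μ (sᶜ ∩ {ω | c ≤ h ω}) ≤ ∫⁻ ω in sᶜ ∩ {ω | c ≤ h ω}, h ω ∂μ := by
    rw [← setLIntegral_const]
    exact setLIntegral_mono hh fun ω hω => hω.2
  calc _ = c * μ s + (c * μ (sᶜ ∩ {ω | c ≤ h ω}) + ∫⁻ ω in sᶜ \ {ω | c ≤ h ω}, h ω ∂μ) := by
        rw [← Set.union_sdiff_self, measure_union Set.disjoint_sdiff_right (hB.diff hs), mul_add,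
          add_assoc, Set.union_sdiff_self, Set.compl_union, Set.sdiff_eq, Set.sdiff_eq,
          Set.inter_comm _ sᶜ]
    _ ≤ _ := by
        rw [← lintegral_inter_add_sdiff h sᶜ hB]
        gcongr

variable {ℱ : Filtration ℕ mΩ} {M : ℕ → Ω → ℝ≥0∞}

/-- The left-hand side is the mean at time `n` of the process stopped on reaching `c`, with its
stopped value lowered to `c`. -/
lemma mul_measure_biUnion_add_setLIntegral_compl_le (hM : ∀ n, Measurable[ℱ n] (M n))
    (hstep : ∀ n s, MeasurableSet[ℱ n] s → ∫⁻ ω in s, M (n + 1) ω ∂μ ≤ ∫⁻ ω in s, M n ω ∂μ)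
    (c : ℝ≥0∞) (n : ℕ) :
    c * μ (⋃ k < n, {ω | c ≤ M k ω}) + ∫⁻ ω in (⋃ k < n, {ω | c ≤ M k ω})ᶜ, M n ω ∂μ ≤
      ∫⁻ ω, M 0 ω ∂μ := by
  have hunion (n l : ℕ) (hl : ∀ k < n, k ≤ l) :
      MeasurableSet[ℱ l] (⋃ k < n, {ω | c ≤ M k ω}) :=
    .biUnion (Set.to_countable _) fun k hk =>
      (hM k).mono (ℱ.mono (hl k hk)) le_rfl measurableSet_Ici
  induction n with
  | zero => simp
  | succ n ih =>
    refine le_trans ?_ ih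
    calc _ ≤ c * μ (⋃ k < n + 1, {ω | c ≤ M k ω}) +
          ∫⁻ ω in (⋃ k < n + 1, {ω | c ≤ M k ω})ᶜ, M n ω ∂μ :=
        add_le_add_right (hstep n _ (hunion (n + 1) n fun k => Nat.lt_succ_iff.1).compl) _
      _ ≤ _ := by
        rw [Set.biUnion_lt_succ]
        exact mul_measure_union_add_setLIntegral_compl_le ((hM n).mono (ℱ.le n) le_rfl)
          (ℱ.le n _ (hunion n n fun k hk => hk.le)) c

lemma mul_measure_exists_le_le_lintegral (hM : ∀ n, Measurable[ℱ n] (M n))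
    (hstep : ∀ n s, MeasurableSet[ℱ n] s → ∫⁻ ω in s, M (n + 1) ω ∂μ ≤ ∫⁻ ω in s, M n ω ∂μ)
    (c : ℝ≥0∞) : c * μ {ω | ∃ n, c ≤ M n ω} ≤ ∫⁻ ω, M 0 ω ∂μ := by
  have hmono : Monotone fun n => ⋃ k < n, {ω | c ≤ M k ω} := fun _ _ hmn =>
    Set.biUnion_subset_biUnion_left fun _ hk => lt_of_lt_of_le hk hmn
  have hunion : {ω | ∃ n, c ≤ M n ω} = ⋃ n, ⋃ k < n, {ω | c ≤ M k ω} := by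
    ext ω
    simp only [Set.mem_ofPred_eq, Set.mem_iUnion, exists_prop]
    exact ⟨fun ⟨n, h⟩ => ⟨n + 1, n, n.lt_succ_self, h⟩, fun ⟨_, k, _, h⟩ => ⟨k, h⟩⟩
  rw [hunion, hmono.measure_iUnion, ENNReal.mul_iSup]
  exact iSup_le fun n =>
    le_self_add.trans (mul_measure_biUnion_add_setLIntegral_compl_le hM hstep c n)

lemma measurableSet_forall_lt (hM : ∀ n, Measurable[ℱ n] (M n)) (c : ℝ≥0∞) :
    MeasurableSet {ω | ∀ n, M n ω < c} := by
  rw [Set.ofPred_forall]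
  exact .iInter fun n => measurableSet_lt ((hM n).mono (ℱ.le n) le_rfl) measurable_const

lemma one_sub_inv_le_measure_forall_lt [IsProbabilityMeasure μ]
    (hM : ∀ n, Measurable[ℱ n] (M n))
    (hstep : ∀ n s, MeasurableSet[ℱ n] s → ∫⁻ ω in s, M (n + 1) ω ∂μ ≤ ∫⁻ ω in s, M n ω ∂μ)
    (hzero : ∫⁻ ω, M 0 ω ∂μ ≤ 1) (c : ℝ≥0∞) : 1 - c⁻¹ ≤ μ {ω | ∀ n, M n ω < c} := by
  have hcompl : {ω | ∀ n, M n ω < c}ᶜ = {ω | ∃ n, c ≤ M n ω} := by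
    ext ω
    simp only [Set.mem_compl_iff, Set.mem_ofPred_eq, not_forall, not_lt]
  have hville : μ {ω | ∃ n, c ≤ M n ω} ≤ c⁻¹ := by
    rw [ENNReal.le_inv_iff_mul_le, mul_comm]
    exact (mul_measure_exists_le_le_lintegral hM hstep c).trans hzero
  rw [← compl_compl {ω | ∀ n, M n ω < c}, hcompl,
    prob_compl_eq_one_sub (hcompl ▸ (measurableSet_forall_lt hM c).compl)]
  exact tsub_le_tsub_left hville 1

end Ville

section MixtureWealth

lemma setLIntegral_mul_le_of_indep {Ω : Type*} {m₁ m₂ mΩ : MeasurableSpace Ω}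
    {Pr : Measure Ω} (hm₁ : m₁ ≤ mΩ) (hm₂ : m₂ ≤ mΩ) (hindep : Indep m₁ m₂ Pr)
    {F G : Ω → ℝ≥0∞}
    (hF : Measurable[m₁] F) (hG : Measurable[m₂] G) (hG1 : ∫⁻ ω, G ω ∂Pr ≤ 1) {s : Set Ω}
    (hs : MeasurableSet[m₁] s) : ∫⁻ ω in s, F ω * G ω ∂Pr ≤ ∫⁻ ω in s, F ω ∂Pr := by
  rw [← lintegral_indicator (hm₁ s hs), ← lintegral_indicator (hm₁ s hs)]
  simp only [Set.indicator_mul_left]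
  rw [lintegral_mul_eq_lintegral_mul_lintegral_of_independent_measurableSpace hm₁ hm₂ hindep
    (hF.indicator hs) hG]
  exact mul_le_of_le_one_right' hG1

variable {Ω β Z : Type*} {mΩ : MeasurableSpace Ω} [mβ : MeasurableSpace β] [MeasurableSpace Z]

/-- The filtration generated by an initial segment of a process: at time `n` it knows `X i` for
`i < n` only, so that `X n` is the next, still unknown, observation. -/
def prefixFiltration (X : ℕ → Ω → β) (hX : ∀ i, Measurable (X i)) : Filtration ℕ mΩ where
  seq n := ⨆ i ∈ Set.Iio n, mβ.comap (X i)
  mono' _ _ hmn := biSup_mono fun _ hi => lt_of_lt_of_le hi hmn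
  le' _ := iSup₂_le fun i _ => (hX i).comap_le

lemma measurable_prefixFiltration {X : ℕ → Ω → β} (hX : ∀ i, Measurable (X i)) {i n : ℕ}
    (hi : i < n) : Measurable[prefixFiltration X hX n] (X i) :=
  (comap_measurable (X i)).mono (le_iSup₂_of_le i hi le_rfl) le_rfl

lemma indep_prefixFiltration_comap {Pr : Measure Ω} {X : ℕ → Ω → β}
    (hX : ∀ i, Measurable (X i)) (hindep : iIndepFun X Pr) (n : ℕ) :
    Indep (prefixFiltration X hX n) (mβ.comap (X n)) Pr := by
  have h := indep_iSup_of_disjoint (fun i => (hX i).comap_le) hindep.iIndep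
    (S := Set.Iio n) (T := {n}) (Set.disjoint_singleton_right.2 (lt_irrefl n))
  rwa [iSup_singleton] at h

/-- The average over `z ∼ ν` of the wealth `∏ i, g z (x i)` of the gambler who multiplies his
capital by `g z (x i)` when the `i`-th observation is `x i`. -/
noncomputable def mixtureWealth (ν : Measure Z) (g : Z → β → ℝ≥0∞) {n : ℕ} (x : Fin n → β) :
    ℝ≥0∞ :=
  ∫⁻ z, ∏ i, g z (x i) ∂ν

lemma measurable_mixtureWealth (ν : Measure Z) [SFinite ν] {g : Z → β → ℝ≥0∞}
    (hg : Measurable (Function.uncurry g)) (n : ℕ) :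
    Measurable (mixtureWealth ν g (n := n)) :=
  Measurable.lintegral_prod_right' (f := fun p : (Fin n → β) × Z => ∏ i, g p.2 (p.1 i)) <|
    Finset.measurable_fun_prod _ fun i _ =>
      hg.comp (measurable_snd.prodMk ((measurable_pi_apply i).comp measurable_fst))

variable {Pr : Measure Ω} {X : ℕ → Ω → β} {ν : Measure Z} [SFinite ν] {g : Z → β → ℝ≥0∞}

lemma measurable_mixtureWealth_prefix (hX : ∀ i, Measurable (X i))
    (hg : Measurable (Function.uncurry g)) (n : ℕ) :
    Measurable[prefixFiltration X hX n] fun ω => mixtureWealth ν g fun i : Fin n => X i ω :=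
  (measurable_mixtureWealth ν hg n).comp
    (@measurable_pi_lambda _ _ _ (prefixFiltration X hX n) _ _ fun i =>
      measurable_prefixFiltration hX i.2)

lemma setLIntegral_mixtureWealth [SFinite Pr] (hX : ∀ i, Measurable (X i))
    (hg : Measurable (Function.uncurry g)) (n : ℕ) (s : Set Ω) :
    ∫⁻ ω in s, mixtureWealth ν g (fun i : Fin n => X i ω) ∂Pr =
      ∫⁻ z, ∫⁻ ω in s, ∏ i : Fin n, g z (X i ω) ∂Pr ∂ν := by
  refine lintegral_lintegral_swap (Measurable.aemeasurable ?_)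
  exact Finset.measurable_fun_prod _ fun i _ =>
    hg.comp (measurable_snd.prodMk ((hX i).comp measurable_fst))

lemma setLIntegral_mixtureWealth_succ_le [SFinite Pr] (hX : ∀ i, Measurable (X i))
    (hindep : iIndepFun X Pr) (hg : Measurable (Function.uncurry g))
    (hmean : ∀ᵐ z ∂ν, ∀ i, ∫⁻ ω, g z (X i ω) ∂Pr ≤ 1) (n : ℕ) {s : Set Ω}
    (hs : MeasurableSet[prefixFiltration X hX n] s) :
    ∫⁻ ω in s, mixtureWealth ν g (fun i : Fin (n + 1) => X i ω) ∂Pr ≤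
      ∫⁻ ω in s, mixtureWealth ν g (fun i : Fin n => X i ω) ∂Pr := by
  rw [setLIntegral_mixtureWealth hX hg, setLIntegral_mixtureWealth hX hg]
  refine lintegral_mono_ae (hmean.mono fun z hz => ?_)
  have hgz : Measurable (g z) := hg.of_uncurry_left
  simp only [Fin.prod_univ_castSucc]
  refine setLIntegral_mul_le_of_indep ((prefixFiltration X hX).le n) (hX n).comap_le
    (indep_prefixFiltration_comap hX hindep n) ?_ (hgz.comp (comap_measurable (X n))) (hz n) hs
  exact @Finset.measurable_fun_prod _ _ _ _ _ _ (prefixFiltration X hX n) _ _ fun i _ =>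
    hgz.comp (measurable_prefixFiltration hX i.2)

lemma one_sub_inv_le_measure_forall_mixtureWealth_lt [IsProbabilityMeasure Pr]
    [IsProbabilityMeasure ν] (hX : ∀ i, Measurable (X i)) (hindep : iIndepFun X Pr)
    (hg : Measurable (Function.uncurry g))
    (hmean : ∀ᵐ z ∂ν, ∀ i, ∫⁻ ω, g z (X i ω) ∂Pr ≤ 1) (c : ℝ≥0∞) :
    1 - c⁻¹ ≤ Pr {ω | ∀ n, mixtureWealth ν g (fun i : Fin n => X i ω) < c} := by
  refine one_sub_inv_le_measure_forall_lt (measurable_mixtureWealth_prefix hX hg)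
    (fun n s hs => setLIntegral_mixtureWealth_succ_le hX hindep hg hmean n hs) ?_ c
  simp [mixtureWealth]

end MixtureWealth

section DonskerVaradhan

open InformationTheory

variable {α : Type*} [MeasurableSpace α] {Q P : Measure α} [IsProbabilityMeasure Q]
  [IsProbabilityMeasure P] {h : α → ℝ}

/-- The **Donsker–Varadhan** inequality: the slack is the divergence of `Q` from the exponential
tilting of `P` by `h`. -/
lemma integral_le_toReal_klDiv_add_log_integral_exp (hkl : klDiv Q P ≠ ⊤) (hh : Integrable h Q)
    (hexp : Integrable (fun a => Real.exp (h a)) P) :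
    ∫ a, h a ∂Q ≤ (klDiv Q P).toReal + Real.log (∫ a, Real.exp (h a) ∂P) := by
  obtain ⟨hac, hllr⟩ := klDiv_ne_top_iff.1 hkl
  have := isProbabilityMeasure_tilted hexp
  have hnonneg := integral_llr_add_sub_measure_univ_nonneg
    (hac.trans (absolutelyContinuous_tilted hexp)) (integrable_llr_tilted_right hac hh hllr hexp)
  rw [integral_llr_tilted_right hac hh hexp hllr, probReal_univ, probReal_univ] at hnonneg
  rw [toReal_klDiv_of_measure_eq hac (by simp only [measure_univ])]
  linarith

lemma integral_le_toReal_klDiv_add_log_of_lintegral_exp_le (hkl : klDiv Q P ≠ ⊤)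
    (hh : Integrable h Q) (hhm : Measurable h) {K : ℝ} (hK : 0 ≤ K)
    (hle : ∫⁻ a, ENNReal.ofReal (Real.exp (h a)) ∂P ≤ ENNReal.ofReal K) :
    ∫ a, h a ∂Q ≤ (klDiv Q P).toReal + Real.log K := by
  have hpos : 0 ≤ᵐ[P] fun a => Real.exp (h a) :=
    Filter.Eventually.of_forall fun a => (Real.exp_pos _).le
  have hexp : Integrable (fun a => Real.exp (h a)) P :=
    (lintegral_ofReal_ne_top_iff_integrable hhm.exp.aestronglyMeasurable hpos).1
      (hle.trans_lt ENNReal.ofReal_lt_top).ne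
  rw [← ofReal_integral_eq_lintegral_ofReal hexp hpos, ENNReal.ofReal_le_ofReal_iff hK] at hle
  refine (integral_le_toReal_klDiv_add_log_integral_exp hkl hh hexp).trans ?_
  gcongr
  exact integral_exp_pos hexp

end DonskerVaradhan

section BettingFraction

lemma sq_le_of_forall_mul_sub_le {c V Δ : ℝ} (hV : 0 ≤ V)
    (h : ∀ g : ℝ, |g| < 1 → g * Δ - g ^ 2 / (2 * (1 - |g|)) * V ≤ c) :
    |Δ| ^ 2 ≤ 2 * c * V + 2 * c * |Δ| := by
  have : 0 ≤ c := by simpa using h 0 (by simp)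
  rcases hV.eq_or_lt with rfl | hV
  · have hhalf : |(1 / 2 : ℝ)| < 1 := by norm_num [abs_of_pos]
    have hup := h (1 / 2) hhalf
    have hlow := h (-(1 / 2)) ((abs_neg _).trans_lt hhalf)
    have habs : |Δ| ≤ 2 * c := abs_le'.2 ⟨by linarith, by linarith⟩
    rw [mul_zero, zero_add, sq]
    exact mul_le_mul_of_nonneg_right habs (abs_nonneg Δ)
  · have hpos : 0 < V + |Δ| := by positivity
    have habs : |Δ / (V + |Δ|)| = |Δ| / (V + |Δ|) := by rw [abs_div, abs_of_pos hpos]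
    have hbet := h (Δ / (V + |Δ|)) (by rw [habs, div_lt_one hpos]; linarith)
    have hcompl : 1 - |Δ| / (V + |Δ|) = V / (V + |Δ|) := by field_simp; ring
    have hvalue : Δ / (V + |Δ|) * Δ - (Δ / (V + |Δ|)) ^ 2 / (2 * (V / (V + |Δ|))) * V =
        |Δ| ^ 2 / (2 * (V + |Δ|)) := by
      rw [sq_abs]; field_simp; ring
    rw [habs, hcompl, hvalue, div_le_iff₀ (by positivity)] at hbet
    linarith

lemma le_sqrt_add_of_sq_le {p q t : ℝ} (hp : 0 ≤ p) (hq : 0 ≤ q) (h : t ^ 2 ≤ p + q * t) :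
    t ≤ √p + q := by
  by_contra! hlt
  have hsqrt := Real.sq_sqrt hp
  nlinarith [Real.sqrt_nonneg p]

lemma abs_le_sqrt_add_of_forall_mul_sub_le {n c V Δ : ℝ} (hn : 0 < n) (hV : 0 ≤ V)
    (h : ∀ g : ℝ, |g| < 1 → n * (g * Δ - g ^ 2 / (2 * (1 - |g|)) * V) ≤ c) :
    |Δ| ≤ √(2 * c * V) / √n + 2 * c / n := by
  have hc : 0 ≤ c := by simpa using h 0 (by simp)
  have hsq := sq_le_of_forall_mul_sub_le hV fun g hg => (le_div_iff₀' hn).2 (h g hg)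
  rw [← mul_div_assoc, ← mul_div_right_comm] at hsq
  rw [← Real.sqrt_div' _ hn.le]
  exact le_sqrt_add_of_sq_le (by positivity) (by positivity) hsq

lemma ofReal_abs_le_of_forall_mul_sub_le {n : ℕ} (hn : 1 ≤ n) {C : ℝ≥0∞} {V Δ : ℝ} (hV : 0 ≤ V)
    (h : C ≠ ⊤ → ∀ g : ℝ, |g| < 1 → n * (g * Δ - g ^ 2 / (2 * (1 - |g|)) * V) ≤ C.toReal) :
    ENNReal.ofReal |Δ| ≤
      (2 * C * ENNReal.ofReal V) ^ (1 / 2 : ℝ) / (n : ℝ≥0∞) ^ (1 / 2 : ℝ) + 2 * C / n := by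
  have hn0 : (0 : ℝ) < n := by exact_mod_cast hn
  by_cases hC : C = ⊤
  · rw [hC, ENNReal.mul_top two_ne_zero, ENNReal.top_div_of_ne_top (ENNReal.natCast_ne_top n),
      add_top]
    exact le_top
  have : 0 ≤ C.toReal := ENNReal.toReal_nonneg
  have h2C : 2 * C = ENNReal.ofReal (2 * C.toReal) := by
    rw [ENNReal.ofReal_mul zero_le_two, ENNReal.ofReal_toReal hC, ENNReal.ofReal_ofNat]
  calc ENNReal.ofReal |Δ|
      ≤ ENNReal.ofReal (√(2 * C.toReal * V) / √n + 2 * C.toReal / n) :=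
        ENNReal.ofReal_le_ofReal (abs_le_sqrt_add_of_forall_mul_sub_le hn0 hV (h hC))
    _ = _ := by
        rw [ENNReal.ofReal_add (by positivity) (by positivity),
          ENNReal.ofReal_div_of_pos (Real.sqrt_pos.2 hn0), ENNReal.ofReal_div_of_pos hn0, h2C,
          ← ENNReal.ofReal_mul (by positivity), Real.sqrt_eq_rpow, Real.sqrt_eq_rpow,
          ← ENNReal.ofReal_rpow_of_nonneg (by positivity) (by norm_num),
          ← ENNReal.ofReal_rpow_of_nonneg hn0.le (by norm_num), ENNReal.ofReal_natCast]

lemma le_bernsteinWidth (n : ℕ) (C V : ℝ≥0∞) :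
    (2 * C * V) ^ (1 / 2 : ℝ) / (n : ℝ≥0∞) ^ (1 / 2 : ℝ) + 2 * C / n ≤ bernsteinWidth n C V :=
  add_le_add (ENNReal.div_le_div_left tsub_le_self _) (ENNReal.div_le_div_left tsub_le_self _)

end BettingFraction

section SampleMoments

variable {Ω 𝒳 Θ : Type*} [MeasurableSpace Ω] {f : Θ → 𝒳 → ℝ}

lemma mean_mem_Icc (Pr : Measure Ω) [IsProbabilityMeasure Pr] {Y : Ω → 𝒳} {θ : Θ}
    (hf : ∀ x, f θ x ∈ Set.Icc (0 : ℝ) 1) : mean Pr Y f θ ∈ Set.Icc (0 : ℝ) 1 := by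
  refine ⟨integral_nonneg fun ω => (hf (Y ω)).1, ?_⟩
  have hle := integral_mono_of_nonneg (Filter.Eventually.of_forall fun ω => (hf (Y ω)).1)
    (integrable_const (μ := Pr) 1) (Filter.Eventually.of_forall fun ω => (hf (Y ω)).2)
  rwa [integral_const, probReal_univ, one_smul] at hle

lemma empMean_mem_Icc {n : ℕ} {x : Fin n → 𝒳} {θ : Θ}
    (hf : ∀ i, f θ (x i) ∈ Set.Icc (0 : ℝ) 1) : empMean f x θ ∈ Set.Icc (0 : ℝ) 1 := by
  refine ⟨mul_nonneg (by positivity) (Finset.sum_nonneg fun i _ => (hf i).1), ?_⟩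
  rw [empMean, one_div, inv_mul_eq_div]
  refine div_le_one_of_le₀ ?_ n.cast_nonneg
  simpa using Finset.sum_le_card_nsmul Finset.univ _ 1 fun i _ => (hf i).2

lemma bernsteinExponent_empMean (g m : ℝ) {n : ℕ} (hn : n ≠ 0) (x : Fin n → 𝒳) (θ : Θ) :
    bernsteinExponent g m (empMean f x θ) (fun i => f θ (x i)) =
      n * (g * (empMean f x θ - m) - g ^ 2 / (2 * (1 - |g|)) *
        (1 / n * ∑ i, (f θ (x i) - empMean f x θ) ^ 2)) := by
  have hsum : ∑ i, f θ (x i) = n * empMean f x θ := by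
    rw [empMean]; field_simp
  rw [bernsteinExponent, Finset.sum_sub_distrib, ← Finset.mul_sum, ← Finset.mul_sum,
    Finset.sum_sub_distrib, Finset.sum_const, Finset.card_univ, Fintype.card_fin, nsmul_eq_mul,
    hsum]
  field_simp

variable [MeasurableSpace Θ]

lemma sampleVar_nonneg (f : Θ → 𝒳 → ℝ) {n : ℕ} (x : Fin n → 𝒳) (Q : Measure Θ) :
    0 ≤ sampleVar f x Q :=
  mul_nonneg (by positivity)
    (integral_nonneg fun _ => Finset.sum_nonneg fun _ _ => sq_nonneg _)

lemma measurable_empMean (hf : ∀ x, Measurable fun θ => f θ x) {n : ℕ} (x : Fin n → 𝒳) :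
    Measurable (empMean f x) :=
  (Finset.measurable_fun_sum _ fun i _ => hf (x i)).const_mul _

lemma integrable_sum_sq_sub_empMean (Q : Measure Θ) [IsFiniteMeasure Q]
    (hf : ∀ x, Measurable fun θ => f θ x) (hf01 : ∀ θ x, f θ x ∈ Set.Icc (0 : ℝ) 1) {n : ℕ}
    (x : Fin n → 𝒳) : Integrable (fun θ => ∑ i, (f θ (x i) - empMean f x θ) ^ 2) Q := by
  refine integrable_finsetSum _ fun i _ => Integrable.of_mem_Icc 0 1
    (((hf (x i)).sub (measurable_empMean hf x)).pow_const 2).aemeasurable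
    (Filter.Eventually.of_forall fun θ => ⟨sq_nonneg _, ?_⟩)
  rw [sq_le_one_iff_abs_le_one]
  exact abs_sub_le_one (hf01 θ (x i)) (empMean_mem_Icc fun i => hf01 θ (x i))

lemma integrable_bernsteinExponent_and_integral_eq (Q : Measure Θ) [IsFiniteMeasure Q]
    (hf : ∀ x, Measurable fun θ => f θ x) (hf01 : ∀ θ x, f θ x ∈ Set.Icc (0 : ℝ) 1)
    {m : Θ → ℝ} (hm : Integrable m Q) {n : ℕ} (hn : n ≠ 0) (x : Fin n → 𝒳) (g : ℝ) :
    Integrable (fun θ => bernsteinExponent g (m θ) (empMean f x θ) fun i => f θ (x i)) Q ∧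
      ∫ θ, bernsteinExponent g (m θ) (empMean f x θ) (fun i => f θ (x i)) ∂Q =
        n * (g * (∫ θ, empMean f x θ ∂Q - ∫ θ, m θ ∂Q) -
          g ^ 2 / (2 * (1 - |g|)) * sampleVar f x Q) := by
  have hemp : Integrable (empMean f x) Q :=
    Integrable.of_mem_Icc 0 1 (measurable_empMean hf x).aemeasurable
      (Filter.Eventually.of_forall fun θ => empMean_mem_Icc fun i => hf01 θ (x i))
  have hgain : Integrable (fun θ => g * (empMean f x θ - m θ)) Q := (hemp.sub hm).const_mul g
  have hvar := ((integrable_sum_sq_sub_empMean Q hf hf01 x).const_mul (1 / (n : ℝ))).const_mul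
    (g ^ 2 / (2 * (1 - |g|)))
  simp only [bernsteinExponent_empMean g _ hn]
  refine ⟨(hgain.sub hvar).const_mul _, ?_⟩
  rw [integral_const_mul, integral_sub hgain hvar, integral_const_mul, integral_const_mul,
    integral_const_mul, integral_sub hemp hm, sampleVar]

end SampleMoments

section Wealth

variable {Ω 𝒳 Θ : Type*} [MeasurableSpace Ω] [MeasurableSpace 𝒳] {f : Θ → 𝒳 → ℝ}

/-- The betting game of hypothesis and portfolio `z = (θ, b)`: the observation `x` is the outcome
`f θ x`, on which the fraction `b` is staked at the odds fair for the mean `m θ`. -/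
noncomputable def wealthFactor (f : Θ → 𝒳 → ℝ) (m : Θ → ℝ) (z : Θ × ℝ) (x : 𝒳) : ℝ≥0∞ :=
  betFactor z.2 (m z.1) (f z.1 x)

lemma lintegral_wealthFactor_le_one {Pr : Measure Ω} [IsProbabilityMeasure Pr] {Y : Ω → 𝒳}
    (hY : Measurable Y) {z : Θ × ℝ} (hf : Measurable (f z.1))
    (hf01 : ∀ x, f z.1 x ∈ Set.Icc (0 : ℝ) 1) (hz : z.2 ∈ Set.Icc (0 : ℝ) 1) :
    ∫⁻ ω, wealthFactor f (mean Pr Y f) z (Y ω) ∂Pr ≤ 1 :=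
  lintegral_betFactor_le_one (hf.comp hY) (fun _ => hf01 _) hz

variable [MeasurableSpace Θ]

lemma ae_lintegral_wealthFactor_le_one (Pr : Measure Ω) [IsProbabilityMeasure Pr]
    (P₀ : Measure Θ) {X : ℕ → Ω → 𝒳} (hX : ∀ i, Measurable (X i))
    (hf : ∀ θ, Measurable (f θ)) (hf01 : ∀ θ x, f θ x ∈ Set.Icc (0 : ℝ) 1) :
    ∀ᵐ z ∂P₀.prod ktPrior, ∀ i, ∫⁻ ω, wealthFactor f (mean Pr (X i) f) z (X i ω) ∂Pr ≤ 1 := by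
  have hportfolio : ∀ᵐ z ∂P₀.prod ktPrior, z.2 ∈ Set.Icc (0 : ℝ) 1 :=
    Measure.quasiMeasurePreserving_snd.ae ae_ktPrior_mem_Icc
  exact hportfolio.mono fun z hz i =>
    lintegral_wealthFactor_le_one (hX i) (hf z.1) (hf01 z.1) hz

lemma measurable_mean (Pr : Measure Ω) [SFinite Pr] {Y : Ω → 𝒳} (hY : Measurable Y)
    (hf : Measurable (Function.uncurry f)) : Measurable (mean Pr Y f) :=
  (hf.comp (measurable_fst.prodMk (hY.comp measurable_snd))).stronglyMeasurable
    |>.integral_prod_right'.measurable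

lemma measurable_wealthFactor (hf : Measurable (Function.uncurry f)) {m : Θ → ℝ}
    (hm : Measurable m) : Measurable (Function.uncurry (wealthFactor f m)) := by
  have : Measurable fun p : (Θ × ℝ) × 𝒳 => f p.1.1 p.2 :=
    hf.comp ((measurable_fst.comp measurable_fst).prodMk measurable_snd)
  unfold wealthFactor betFactor Function.uncurry
  fun_prop

lemma lintegral_exp_bernsteinExponent_le (P₀ : Measure Θ)
    (hf : Measurable (Function.uncurry f)) (hf01 : ∀ θ x, f θ x ∈ Set.Icc (0 : ℝ) 1)
    {m : Θ → ℝ} (hm : Measurable m) (hm01 : ∀ θ, m θ ∈ Set.Icc (0 : ℝ) 1) {n : ℕ}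
    (x : Fin n → 𝒳) {g : ℝ} (hg : |g| < 1) :
    ∫⁻ θ, ENNReal.ofReal (Real.exp
        (bernsteinExponent g (m θ) (empMean f x θ) fun i => f θ (x i))) ∂P₀ ≤
      ENNReal.ofReal (ktRegret n) * mixtureWealth (P₀.prod ktPrior) (wealthFactor f m) x := by
  have hwealth : Measurable fun z : Θ × ℝ => ∏ i, wealthFactor f m z (x i) :=
    Finset.measurable_fun_prod _ fun i _ => (measurable_wealthFactor hf hm).of_uncurry_right
  rw [mixtureWealth, lintegral_prod _ hwealth.aemeasurable,
    ← lintegral_const_mul _ hwealth.lintegral_prod_right']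
  refine lintegral_mono fun θ => ?_
  exact (exp_bernsteinExponent_le_ktRegret_mul_lintegral (fun i => hf01 θ (x i))
    (empMean_mem_Icc fun i => hf01 θ (x i)) (hm01 θ) hg).trans_eq (by rw [Fintype.card_fin]; rfl)

lemma toReal_klDiv_add_log_le_toReal_complexity {n : ℕ} {δ : ℝ} (hδ : 0 < δ) {Q P₀ : Measure Θ}
    (hC : complexity n δ Q P₀ ≠ ⊤) :
    (InformationTheory.klDiv Q P₀).toReal + Real.log (ktRegret n * (1 / δ)) ≤
      (complexity n δ Q P₀).toReal := by
  have hkl : InformationTheory.klDiv Q P₀ ≠ ⊤ := fun h => hC (by simp [complexity, h])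
  rw [complexity, ENNReal.toReal_add (ENNReal.add_ne_top.2 ⟨hkl, ENNReal.ofReal_ne_top⟩)
    ENNReal.ofReal_ne_top, ENNReal.toReal_add hkl ENNReal.ofReal_ne_top,
    Real.log_mul (ktRegret_pos n).ne' (one_div_pos.2 hδ).ne', ← add_assoc]
  have hle (r : ℝ) : r ≤ (ENNReal.ofReal r).toReal :=
    (le_max_left r 0).trans_eq ENNReal.toReal_ofReal'.symm
  exact add_le_add (add_le_add_right (hle _) _) (hle _)

lemma mul_sub_le_toReal_complexity {P₀ Q : Measure Θ} [IsProbabilityMeasure P₀]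
    [IsProbabilityMeasure Q] (hf : Measurable (Function.uncurry f))
    (hf01 : ∀ θ x, f θ x ∈ Set.Icc (0 : ℝ) 1) {m : Θ → ℝ} (hm : Measurable m)
    (hm01 : ∀ θ, m θ ∈ Set.Icc (0 : ℝ) 1) {δ : ℝ} (hδ : 0 < δ) {n : ℕ} (hn : n ≠ 0)
    {x : Fin n → 𝒳}
    (hx : mixtureWealth (P₀.prod ktPrior) (wealthFactor f m) x ≤ ENNReal.ofReal (1 / δ))
    (hC : complexity n δ Q P₀ ≠ ⊤) {g : ℝ} (hg : |g| < 1) :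
    n * (g * (∫ θ, empMean f x θ ∂Q - ∫ θ, m θ ∂Q) - g ^ 2 / (2 * (1 - |g|)) * sampleVar f x Q) ≤
      (complexity n δ Q P₀).toReal := by
  have hfx (y : 𝒳) : Measurable fun θ => f θ y := hf.of_uncurry_right
  have hkl : InformationTheory.klDiv Q P₀ ≠ ⊤ := fun h => hC (by simp [complexity, h])
  have hmQ : Integrable m Q :=
    Integrable.of_mem_Icc 0 1 hm.aemeasurable (Filter.Eventually.of_forall hm01)
  have hmeas :
      Measurable fun θ => bernsteinExponent g (m θ) (empMean f x θ) fun i => f θ (x i) := by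
    have := measurable_empMean hfx x
    unfold bernsteinExponent
    fun_prop
  have hexp := (lintegral_exp_bernsteinExponent_le P₀ hf hf01 hm hm01 x hg).trans
    (mul_le_mul_right hx _)
  rw [← ENNReal.ofReal_mul (ktRegret_pos n).le] at hexp
  obtain ⟨hint, hval⟩ := integrable_bernsteinExponent_and_integral_eq Q hfx hf01 hmQ hn x g
  rw [← hval]
  exact (integral_le_toReal_klDiv_add_log_of_lintegral_exp_le hkl hint hmeas
    (mul_pos (ktRegret_pos n) (one_div_pos.2 hδ)).le hexp).trans
    (toReal_klDiv_add_log_le_toReal_complexity hδ hC)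

end Wealth

end PACBayes

theorem proposition3_general
    {Ω 𝒳 Θ : Type*} [MeasurableSpace Ω] [MeasurableSpace 𝒳] [MeasurableSpace Θ]
    (Pr : Measure Ω) [IsProbabilityMeasure Pr]
    (X : ℕ → Ω → 𝒳) (hX_meas : ∀ i, Measurable (X i)) (hX_indep : iIndepFun X Pr)
    (f : Θ → 𝒳 → ℝ) (hf_meas : Measurable (Function.uncurry f))
    (hf_range : ∀ θ x, f θ x ∈ Set.Icc (0 : ℝ) 1)
    (hX_mean : ∀ i, PACBayes.mean Pr (X i) f = PACBayes.mean Pr (X 0) f)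
    (δ : ℝ) (hδ : 0 < δ) (P₀ : Measure Θ) [IsProbabilityMeasure P₀] :
    ∃ E : Set Ω, MeasurableSet E ∧ ENNReal.ofReal (1 - δ) ≤ Pr E ∧
      ∀ ω ∈ E, ∀ n : ℕ, 1 ≤ n → ∀ (Q : Measure Θ) [IsProbabilityMeasure Q],
        let S : Fin n → 𝒳 := fun i => X i ω
        let C := PACBayes.complexity n δ Q P₀
        ENNReal.ofReal
            |(∫ θ, PACBayes.mean Pr (X 0) f θ ∂Q) - ∫ θ, PACBayes.empMean f S θ ∂Q|
          ≤ (2 * C * ENNReal.ofReal (PACBayes.sampleVar f S Q)) ^ (1 / 2 : ℝ) /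
              (n : ℝ≥0∞) ^ (1 / 2 : ℝ) + 2 * C / n := by
  set m := PACBayes.mean Pr (X 0) f
  have hm : Measurable m := PACBayes.measurable_mean Pr (hX_meas 0) hf_meas
  have hfactor := PACBayes.measurable_wealthFactor hf_meas hm
  have hfair : ∀ᵐ z ∂P₀.prod PACBayes.ktPrior,
      ∀ i, ∫⁻ ω, PACBayes.wealthFactor f m z (X i ω) ∂Pr ≤ 1 :=
    (PACBayes.ae_lintegral_wealthFactor_le_one Pr P₀ hX_meas (fun θ => hf_meas.of_uncurry_left)
      hf_range).mono fun z hz i => by simpa only [m, hX_mean i] using hz i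
  have hδ_compl : ENNReal.ofReal (1 - δ) = 1 - (ENNReal.ofReal (1 / δ))⁻¹ := by
    rw [← ENNReal.ofReal_inv_of_pos (one_div_pos.2 hδ), one_div, inv_inv, ← ENNReal.ofReal_one,
      ← ENNReal.ofReal_sub _ hδ.le]
  refine ⟨_, PACBayes.measurableSet_forall_lt
    (PACBayes.measurable_mixtureWealth_prefix (ν := P₀.prod PACBayes.ktPrior) hX_meas hfactor)
    (ENNReal.ofReal (1 / δ)), hδ_compl.trans_le
    (PACBayes.one_sub_inv_le_measure_forall_mixtureWealth_lt hX_meas hX_indep hfactor hfair _),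
    fun ω hω n hn Q _ => ?_⟩
  intro S C
  rw [abs_sub_comm]
  exact PACBayes.ofReal_abs_le_of_forall_mul_sub_le hn (PACBayes.sampleVar_nonneg f _ Q)
    fun hC g hg => PACBayes.mul_sub_le_toReal_complexity hf_meas hf_range hm
      (fun θ => PACBayes.mean_mem_Icc Pr (hf_range θ)) hδ (Nat.one_le_iff_ne_zero.1 hn)
      (hω n).le hC hg

theorem proposition3
    {Ω 𝒳 Θ : Type*} [MeasurableSpace Ω] [MeasurableSpace 𝒳] [MeasurableSpace Θ]
    (Pr : Measure Ω) [IsProbabilityMeasure Pr]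
    (X : ℕ → Ω → 𝒳) (hX_meas : ∀ i, Measurable (X i))
    (hX_indep : iIndepFun X Pr) (hX_ident : ∀ i, IdentDistrib (X i) (X 0) Pr Pr)
    (f : Θ → 𝒳 → ℝ) (hf_meas : Measurable (Function.uncurry f))
    (hf_range : ∀ θ x, f θ x ∈ Set.Icc (0 : ℝ) 1)
    (δ : ℝ) (hδ : δ ∈ Set.Ioc (0 : ℝ) 1)
    (P₀ : Measure Θ) [IsProbabilityMeasure P₀] :
    ∃ E : Set Ω, MeasurableSet E ∧ ENNReal.ofReal (1 - δ) ≤ Pr E ∧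
      ∀ ω ∈ E, ∀ n : ℕ, 1 ≤ n → ∀ (P : Kernel (Fin n → 𝒳) Θ) [IsMarkovKernel P],
        let S : Fin n → 𝒳 := fun i => X i ω
        ENNReal.ofReal
            |(∫ θ, PACBayes.mean Pr (X 0) f θ ∂(P S)) - ∫ θ, PACBayes.empMean f S θ ∂(P S)|
          ≤ PACBayes.bernsteinWidth n (PACBayes.complexity n δ (P S) P₀)
              (ENNReal.ofReal (PACBayes.sampleVar f S (P S))) := by
  have hX_mean (i : ℕ) : PACBayes.mean Pr (X i) f = PACBayes.mean Pr (X 0) f :=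
    funext fun θ => ((hX_ident i).comp (u := f θ) hf_meas.of_uncurry_left).integral_eq
  obtain ⟨E, hE, hPrE, hbound⟩ := proposition3_general Pr X hX_meas hX_indep f hf_meas hf_range
    hX_mean δ hδ.1 P₀
  exact ⟨E, hE, hPrE, fun ω hω n hn P _ =>
    (hbound ω hω n hn (P _)).trans (PACBayes.le_bernsteinWidth _ _ _)⟩
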